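/- All graphs are finite, simple and undirected. A graph $G$ is $(k,d)$-colourable if its vertices can be coloured with $k$ colours so that every vertex has at most $d$ neighbours of its own colour. A graph $H$ is a minor of $G$ if a graph isomorphic to $H$ can be obtained from a subgraph of $G$ by contracting edges; otherwise $G$ is $H$-minor-free. Let $f(H)$ be the defective chromatic number of the class of $H$-minor-free graphs, that is, the minimum integer $k\ge 0$ for which there is an integer $d\geq 0$ such that every $H$-minor-free graph is $(k,d)$-colourable. Let $\tau(H)$ be the vertex cover number of $H$, the minimum size of a set of vertices that meets every edge of $H$. For a connected graph $H$, the tree-depth $\mathrm{td}(H)$ is the minimum height of a rooted tree $T$ such that $H$ is a subgraph of the closure of $T$, where the height of $T$ is the maximum number of vertices on a root-to-leaf path, and the closure of $T$ is obtained by adding an edge between every ancestor and descendant. For a general graph $H$, $\mathrm{td}(H)$ is the maximum tree-depth of the connected components of $H$ (and $0$ if $H$ has no vertices). **Proposition.** For every graph $H$, the number $f(H)$ exists and satisfies $$\mathrm{td}(H)-1\le f(H).$$ If moreover $H$ has at least one edge or at most one vertex, then $$f(H)\le\tau(H).$$ -/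

import Mathlib

universe u

namespace SimpleGraph

/-- `G` is `(k,d)`-colourable: the vertices can be coloured with `k` colours so that every vertex
has at most `d` neighbours of its own colour. -/
def DefectiveColorable {V : Type u} (G : SimpleGraph V) (k d : ℕ) : Prop :=
  ∃ c : V → Fin k, ∀ v : V, {w : V | G.Adj v w ∧ c w = c v}.encard ≤ d

/-- `H` is isomorphic to a graph obtained from `G` by contracting edges. The fibres of `π` are the
connected vertex sets that are contracted to single vertices; loops and parallel edges are
discarded. (`Connected` includes non-emptiness, so `π` is surjective.) -/
def IsContractionOf {W V : Type u} (H : SimpleGraph W) (G : SimpleGraph V) : Prop :=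
  ∃ π : V → W,
    (∀ w : W, (G.induce {x : V | π x = w}).Connected) ∧
    ∀ a b : W, H.Adj a b ↔ a ≠ b ∧ ∃ x y : V, π x = a ∧ π y = b ∧ G.Adj x y

/-- `H` is a minor of `G`: a graph isomorphic to `H` can be obtained from a subgraph of `G` by
contracting edges. -/
def IsMinorOf {W V : Type u} (H : SimpleGraph W) (G : SimpleGraph V) : Prop :=
  ∃ G' : G.Subgraph, H.IsContractionOf G'.coe

/-- In the tree `T` rooted at `r`, the vertex `a` is an ancestor of `b` (possibly `a = b`):
`a` lies on the path from `r` to `b`. -/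
def IsAncestor {N : Type u} (T : SimpleGraph N) (r a b : N) : Prop :=
  ∃ p : T.Walk r b, p.IsPath ∧ a ∈ p.support

/-- The closure of the tree `T` rooted at `r`: distinct vertices are adjacent exactly when one is
an ancestor of the other. -/
def rootedClosure {N : Type u} (T : SimpleGraph N) (r : N) : SimpleGraph N :=
  SimpleGraph.fromRel (T.IsAncestor r)

/-- The height of the finite tree `T` rooted at `r`: the maximum number of vertices on a path from
the root to a vertex (a longest such path ends at a leaf). -/
noncomputable def rootedHeight {N : Type u} (T : SimpleGraph N) (r : N) : ℕ :=
  ⨆ v : N, (T.dist r v + 1)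

/-- The tree-depth of a finite connected graph `H`: the minimum height of a rooted tree whose
closure contains `H` as a subgraph. -/
noncomputable def connectedTreeDepth {V : Type u} (H : SimpleGraph V) : ℕ :=
  sInf {h : ℕ | ∃ (N : Type u) (_ : Finite N) (T : SimpleGraph N) (r : N),
    T.IsTree ∧ H.IsContained (T.rootedClosure r) ∧ T.rootedHeight r = h}

/-- The tree-depth of a finite graph: the maximum tree-depth of its connected components
(`0` for the graph without vertices). -/
noncomputable def treeDepth {V : Type u} (H : SimpleGraph V) : ℕ :=
  ⨆ C : H.ConnectedComponent, C.toSimpleGraph.connectedTreeDepth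

end SimpleGraph

/-- A class of graphs, as a predicate on simple graphs. -/
def GraphClass : Type (u + 1) := (V : Type u) → SimpleGraph V → Prop

/-- `k` is the defective chromatic number of the class of finite graphs `𝒞`: the minimum `k` for
which there is a `d` such that every finite graph in `𝒞` is `(k,d)`-colourable. -/
def IsDefectiveChromaticNumber (𝒞 : GraphClass.{u}) (k : ℕ) : Prop :=
  IsLeast {k : ℕ | ∃ d : ℕ, ∀ (V : Type u) [Finite V] (G : SimpleGraph V),
    𝒞 V G → G.DefectiveColorable k d} k

/-- The class of `H`-minor-free graphs. -/
def minorFreeClass {W : Type u} (H : SimpleGraph W) : GraphClass.{u} :=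
  fun _ G => ¬ H.IsMinorOf G

/-! Lower bound. Take the closure of the complete `(d + 1)`-ary tree with `k + 1` levels, realised
as words of length at most `k` under the suffix order. Descending from the root, one can always pick
a child whose subtree avoids the colour of the current vertex, so `k` colours with defect `d` do not
suffice (`not_defectiveColorable_suffixGraph`). If every `H`-minor-free graph is `(k,d)`-colourable,
then `H` is a minor of this closure. A connected set in the closure has a topmost vertex, and
sending each branch set to it makes `H` a subgraph, so its components have tree-depth at most `k +
1`.

Upper bound. Let `C` be a nonempty vertex cover of `H`. Every `H`-minor-free graph with an edge has
a vertex of positive degree below `|C|`, or an edge with both ends of bounded degree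
(`exists_low_degree_or_light_edge`). Deleting the edges at that vertex, or that edge, is harmless
for colouring with `|C|` colours, so induction on the number of edges applies. Otherwise the
low-degree non-isolated vertices form an independent set `A` whose neighbours all lie in the set `X`
of high-degree vertices. Contract as many vertices of `A` as possible into distinct new edges on
`X`. By Mader's theorem the resulting graph `J` is sparse, so few vertices are contracted and `J`
has few cliques. Each remaining vertex of `A` sees a `J`-clique of size `|C|`, and no clique is
chosen often, since that would give an `H`-minor. So `|A| = O(|X|)`, and sparsity of `G` contradicts
the high degrees in `X`. -/

namespace SimpleGraph

/-! ### Minor models by branch sets -/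

/-- The sets `B w` are the branch sets of a model of `H` as a minor of `G`. -/
structure IsMinorModel {W V : Type*} (H : SimpleGraph W) (G : SimpleGraph V)
    (B : W → Set V) : Prop where
  connected : ∀ w, (G.induce (B w)).Connected
  disjoint : ∀ a b x, x ∈ B a → x ∈ B b → a = b
  adj : ∀ a b, H.Adj a b → ∃ x ∈ B a, ∃ y ∈ B b, G.Adj x y

theorem IsMinorModel.mono {W V : Type*} {H : SimpleGraph W} {G G' : SimpleGraph V}
    {B : W → Set V} (h : H.IsMinorModel G B) (hG : G ≤ G') : H.IsMinorModel G' B where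
  connected w := (h.connected w).mono fun _ _ hxy => hG hxy
  disjoint := h.disjoint
  adj a b hab := by
    obtain ⟨x, hx, y, hy, hxy⟩ := h.adj a b hab
    exact ⟨x, hx, y, hy, hG hxy⟩

theorem IsMinorModel.comp {W W' V : Type*} {H : SimpleGraph W} {H' : SimpleGraph W'}
    {G : SimpleGraph V} {B : W → Set V} (h : H.IsMinorModel G B) (f : H' →g H)
    (hf : Function.Injective f) : H'.IsMinorModel G (fun w => B (f w)) where
  connected _ := h.connected _
  disjoint _ _ x ha hb := hf (h.disjoint _ _ x ha hb)
  adj _ _ hab := h.adj _ _ (f.map_adj hab)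

theorem connected_induce_singleton {V : Type*} (G : SimpleGraph V) (x : V) :
    (G.induce {x}).Connected := by
  have : Nonempty ({x} : Set V) := ⟨⟨x, rfl⟩⟩
  exact ⟨fun a b => by rw [Subsingleton.elim a b]⟩

theorem isMinorModel_singleton {W V : Type*} {H : SimpleGraph W} {G : SimpleGraph V}
    (f : H →g G) (hf : Function.Injective f) : H.IsMinorModel G (fun w => {f w}) where
  connected w := connected_induce_singleton G (f w)
  disjoint a b x ha hb := by
    simp only [Set.mem_singleton_iff] at ha hb
    exact hf (ha.symm.trans hb)
  adj a b hab := ⟨f a, rfl, f b, rfl, f.map_adj hab⟩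

/-- `IsContractionOf` asks for exactly the edges of `H`, so the subgraph must drop the edges of `G`
between branch sets that are non-adjacent in `H`. -/
theorem IsMinorModel.isMinorOf {W V : Type u} {H : SimpleGraph W} {G : SimpleGraph V}
    {B : W → Set V} (h : H.IsMinorModel G B) : H.IsMinorOf G := by
  classical
  let S : G.Subgraph :=
    { verts := ⋃ w, B w
      Adj := fun x y => G.Adj x y ∧ ∃ a b, x ∈ B a ∧ y ∈ B b ∧ (a = b ∨ H.Adj a b)
      adj_sub := fun h => h.1
      edge_vert := fun ⟨_, a, _, ha, _⟩ => Set.mem_iUnion.2 ⟨a, ha⟩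
      symm := ⟨fun x y ⟨hxy, a, b, ha, hb, hab⟩ =>
        ⟨hxy.symm, b, a, hb, ha, hab.imp Eq.symm fun h => h.symm⟩⟩ }
  choose p hp using fun x : S.verts => Set.mem_iUnion.1 x.2
  have hp' : ∀ (x : S.verts) w, (x : V) ∈ B w → p x = w := fun x w hw =>
    h.disjoint _ _ _ (hp x) hw
  refine ⟨S, p, fun w => ?_, fun a b => ⟨fun hab => ?_, ?_⟩⟩
  · let φ : G.induce (B w) →g S.coe.induce {x | p x = w} :=
      { toFun := fun x => ⟨⟨x, Set.mem_iUnion.2 ⟨w, x.2⟩⟩, hp' _ _ x.2⟩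
        map_rel' := fun {x y} hxy => ⟨hxy, w, w, x.2, y.2, Or.inl rfl⟩ }
    refine (h.connected w).map φ ?_
    rintro ⟨x, rfl⟩
    exact ⟨⟨x, hp x⟩, rfl⟩
  · obtain ⟨x, hx, y, hy, hxy⟩ := h.adj a b hab
    exact ⟨hab.ne, ⟨x, Set.mem_iUnion.2 ⟨a, hx⟩⟩, ⟨y, Set.mem_iUnion.2 ⟨b, hy⟩⟩, hp' _ _ hx,
      hp' _ _ hy, hxy, a, b, hx, hy, Or.inr hab⟩
  · rintro ⟨hne, x, y, rfl, rfl, -, a, b, ha, hb, hab⟩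
    rw [hp' x a ha, hp' y b hb] at hne ⊢
    exact hab.resolve_left hne

theorem IsMinorOf.exists_isMinorModel {W V : Type u} {H : SimpleGraph W} {G : SimpleGraph V}
    (h : H.IsMinorOf G) : ∃ B : W → Set V, H.IsMinorModel G B := by
  obtain ⟨S, p, hc, ha⟩ := h
  refine ⟨fun w => Subtype.val '' {x | p x = w}, fun w => ?_, ?_, fun a b hab => ?_⟩
  · let φ : S.coe.induce {x | p x = w} →g G.induce (Subtype.val '' {x | p x = w}) :=
      { toFun := fun x => ⟨x.1, x.1, x.2, rfl⟩
        map_rel' := fun {x y} hxy => S.adj_sub hxy }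
    refine (hc w).map φ ?_
    rintro ⟨_, x, hx, rfl⟩
    exact ⟨⟨x, hx⟩, rfl⟩
  · rintro a b _ ⟨x, hx, rfl⟩ ⟨y, hy, hxy⟩
    rw [Subtype.ext hxy] at hy
    exact hx.symm.trans hy
  · obtain ⟨-, x, y, hx, hy, hxy⟩ := (ha a b).1 hab
    exact ⟨x, ⟨x, hx, rfl⟩, y, ⟨y, hy, rfl⟩, S.adj_sub hxy⟩

/-! ### Lower bound: closures of complete trees -/

section WordTree

variable (α : Type u) (k : ℕ)

/-- Words of length at most `k`: the vertices of the complete `α`-ary tree with `k + 1` levels. -/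
abbrev Word : Type u := {l : List α // l.length ≤ k}

instance [Finite α] : Finite (Word α k) := (List.finite_length_le α k).to_subtype

/-- The empty word. -/
abbrev emptyWord : Word α k := ⟨[], Nat.zero_le k⟩

/-- The complete `α`-ary tree, in which the parent of a word is its tail. -/
def wordTree : SimpleGraph (Word α k) :=
  fromRel fun x y => ∃ a, y.1 = a :: x.1

/-- The graph in which distinct words are adjacent when one is a suffix of the other. -/
def suffixGraph : SimpleGraph (Word α k) :=
  fromRel fun x y => x.1 <:+ y.1

variable {α k}

theorem wordTree_adj_cons (a : α) (l : List α) (h : (a :: l).length ≤ k) :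
    (wordTree α k).Adj ⟨l, (Nat.le_succ _).trans h⟩ ⟨a :: l, h⟩ := by
  refine ⟨fun h => ?_, Or.inl ⟨a, rfl⟩⟩
  have := congrArg (fun x : Word α k => x.1.length) h
  simp at this

theorem exists_wordTree_path (l : List α) (h : l.length ≤ k) :
    ∃ p : (wordTree α k).Walk (emptyWord α k) ⟨l, h⟩, p.IsPath ∧ p.length = l.length ∧
      (∀ x ∈ p.support, x.1 <:+ l) ∧ ∀ x : Word α k, x.1 <:+ l → x ∈ p.support := by
  induction l with
  | nil =>
    refine ⟨.nil, by simp, rfl, by simp [emptyWord], fun x hx => ?_⟩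
    simp only [Walk.support_nil, List.mem_singleton]
    exact Subtype.ext (List.suffix_nil.1 hx)
  | cons a l ih =>
    obtain ⟨p, hp, hl, hs, hs'⟩ := ih ((Nat.le_succ _).trans h)
    refine ⟨p.concat (wordTree_adj_cons a l h), hp.concat (fun hm => ?_) _, by simp [hl],
      fun x hx => ?_, fun x hx => ?_⟩
    · have := (hs _ hm).length_le
      simp at this
    · rw [Walk.support_concat, List.mem_append, List.mem_singleton] at hx
      rcases hx with hx | rfl
      · exact (hs x hx).trans (List.suffix_cons a l)
      · exact List.suffix_rfl
    · rw [Walk.support_concat, List.mem_append, List.mem_singleton]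
      rcases List.suffix_cons_iff.1 hx with hx | hx
      · exact Or.inr (Subtype.ext hx)
      · exact Or.inl (hs' x hx)

theorem wordTree_isTree : (wordTree α k).IsTree := by
  have hr : ∀ x : Word α k, (wordTree α k).Reachable (emptyWord α k) x := fun x => by
    obtain ⟨p, -⟩ := exists_wordTree_path x.1 x.2
    exact ⟨p⟩
  have : Nonempty (Word α k) := ⟨emptyWord α k⟩
  refine ⟨⟨fun x y => (hr x).symm.trans (hr y)⟩, isAcyclic_iff_forall_adj_isBridge.2 ?_⟩
  have key : ∀ (x y : Word α k) (a : α), y.1 = a :: x.1 →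
      -- Without the edge to its parent, no walk leaves the set of words ending in `y`.
      ¬ ((wordTree α k) \ fromEdgeSet {s(x, y)}).Reachable y x := by
    rintro x y a hxy ⟨p⟩
    have inv : ∀ u w, ((wordTree α k) \ fromEdgeSet {s(x, y)}).Walk u w →
        y.1 <:+ u.1 → y.1 <:+ w.1 := by
      intro u w p hyu
      induction p with
      | nil => exact hyu
      | @cons u v w h _ ih =>
        refine ih ?_
        obtain ⟨⟨-, ⟨b, hb⟩ | ⟨b, hb⟩⟩, h2⟩ := h
        · rw [hb]
          exact hyu.trans (List.suffix_cons b _)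
        · rw [hb] at hyu
          rcases List.suffix_cons_iff.1 hyu with h | h
          · exfalso
            obtain rfl : y = u := Subtype.ext (h.trans hb.symm)
            obtain rfl : x = v := Subtype.ext (List.cons.inj (hxy.symm.trans hb)).2
            apply h2
            rw [fromEdgeSet_adj]
            refine ⟨Sym2.eq_swap, fun h => ?_⟩
            have := congrArg (fun z : Word α k => z.1.length) h
            simp [hxy] at this
          · exact h
    have := (inv y x p List.suffix_rfl).length_le
    simp [hxy] at this
  rintro x y ⟨-, ⟨a, ha⟩ | ⟨a, ha⟩⟩
  · rw [isBridge_iff]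
    exact fun h => key x y a ha h.symm
  · rw [isBridge_iff, Sym2.eq_swap]
    exact fun h => key y x a ha h

theorem rootedHeight_wordTree_le : (wordTree α k).rootedHeight (emptyWord α k) ≤ k + 1 := by
  refine ciSup_le' fun x => ?_
  obtain ⟨p, -, hl, -⟩ := exists_wordTree_path x.1 x.2
  exact Nat.succ_le_succ ((dist_le p).trans (hl.trans_le x.2))

theorem suffixGraph_le_rootedClosure :
    suffixGraph α k ≤ (wordTree α k).rootedClosure (emptyWord α k) := by
  have key : ∀ x y : Word α k, x.1 <:+ y.1 → (wordTree α k).IsAncestor (emptyWord α k) x y := by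
    intro x y hxy
    obtain ⟨p, hp, -, -, hs⟩ := exists_wordTree_path y.1 y.2
    exact ⟨p, hp, hs x hxy⟩
  rintro x y ⟨hne, h⟩
  exact ⟨hne, h.imp (key x y) (key y x)⟩

/-- A shortest word `t` works: along an edge the property of ending in `t` persists, because
suffixes of one word are comparable and no word of `S` is shorter than `t`. -/
theorem exists_suffix_of_connected {S : Set (Word α k)}
    (hS : ((suffixGraph α k).induce S).Connected) : ∃ t ∈ S, ∀ x ∈ S, t.1 <:+ x.1 := by
  obtain ⟨⟨s, hs⟩⟩ := hS.nonempty
  obtain ⟨t, ht, hmin⟩ := (measure fun x : Word α k => x.1.length).wf.has_min S ⟨s, hs⟩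
  refine ⟨t, ht, fun x hx => ?_⟩
  obtain ⟨p⟩ := hS.preconnected ⟨t, ht⟩ ⟨x, hx⟩
  suffices ∀ a b : S, ((suffixGraph α k).induce S).Walk a b → t.1 <:+ a.1.1 → t.1 <:+ b.1.1 from
    this _ _ p List.suffix_rfl
  intro a b p hta
  induction p with
  | nil => exact hta
  | @cons a b c h _ ih =>
    refine ih ?_
    obtain ⟨-, h | h⟩ := h
    · exact hta.trans h
    · exact List.suffix_of_suffix_length_le hta h (not_lt.1 (hmin b.1 b.2))

/-- Map each branch set to its topmost word. An edge between two branch sets makes both tops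
suffixes of one word, hence comparable. -/
theorem IsMinorModel.exists_hom_suffixGraph {W : Type*} {H : SimpleGraph W}
    {B : W → Set (Word α k)} (h : H.IsMinorModel (suffixGraph α k) B) :
    ∃ f : H →g suffixGraph α k, Function.Injective f := by
  choose t ht hmin using fun w => exists_suffix_of_connected (h.connected w)
  have hinj : Function.Injective t := fun a b hab => h.disjoint a b _ (ht a) (hab ▸ ht b)
  refine ⟨⟨t, fun {a b} hab => ⟨fun h => hab.ne (hinj h), ?_⟩⟩, hinj⟩
  obtain ⟨x, hx, y, hy, -, hxy⟩ := h.adj a b hab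
  rcases hxy with hxy | hxy
  · exact List.suffix_or_suffix_of_suffix ((hmin a x hx).trans hxy) (hmin b y hy)
  · exact List.suffix_or_suffix_of_suffix (hmin a x hx) ((hmin b y hy).trans hxy)

theorem not_defectiveColorable_suffixGraph {d : ℕ} [Finite α] (hd : d < Nat.card α) :
    ¬ (suffixGraph α k).DefectiveColorable k d := by
  classical
  rintro ⟨c, hc⟩
  have : Nonempty α := Nat.card_pos_iff.1 (by omega) |>.1
  -- `S` is a set of `i` colours missing from the subtree at `x`. If every child subtree contained
  -- the colour of `x`, then `x` would have more than `d` neighbours of its own colour. For `i = k +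
  -- 1` the list `x` is too long to be a word, and only the size of `S` matters.
  have key : ∀ i ≤ k + 1, ∃ (x : List α) (S : Finset (Fin k)), x.length = i ∧ S.card = i ∧
      ∀ y : Word α k, x <:+ y.1 → c y ∉ S := by
    intro i hi
    induction i with
    | zero => exact ⟨[], ∅, rfl, rfl, by simp⟩
    | succ i ih =>
      obtain ⟨x, S, hx, hS, hxS⟩ := ih (by omega)
      let x' : Word α k := ⟨x, by omega⟩
      by_contra! hcon
      have h1 : ∀ a : α, ∃ y : Word α k, a :: x <:+ y.1 ∧ c y = c x' := by
        intro a
        obtain ⟨y, hy, hyS⟩ := hcon (a :: x) (insert (c x') S) (by simp [hx])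
          (by rw [Finset.card_insert_of_notMem (hxS x' List.suffix_rfl), hS])
        refine ⟨y, hy, ?_⟩
        rcases Finset.mem_insert.1 hyS with h | h
        · exact h
        · exact absurd h (hxS y ((List.suffix_cons a x).trans hy))
      choose y hy hyc using h1
      have hinj : Function.Injective y := by
        intro a b hab
        have h2 := hy b
        rw [← hab] at h2
        have := List.suffix_of_suffix_length_le (hy a) h2 (by simp)
        exact (List.cons.inj (this.eq_of_length (by simp))).1
      have hsub : Set.range y ⊆ {w | (suffixGraph α k).Adj x' w ∧ c w = c x'} := by
        rintro _ ⟨a, rfl⟩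
        refine ⟨⟨fun h => ?_, Or.inl ((List.suffix_cons a x).trans (hy a))⟩, hyc a⟩
        have h3 := (hy a).length_le
        rw [← h] at h3
        simp [x'] at h3
      have h4 := (Set.encard_le_encard hsub).trans (hc x')
      rw [← Set.image_univ, hinj.encard_image, Set.encard_univ, ENat.card_eq_coe_natCard] at h4
      exact absurd (ENat.natCast_le_natCast.1 h4) (by omega)
  obtain ⟨x, S, -, hS, -⟩ := key (k + 1) le_rfl
  have := S.card_le_univ
  rw [Fintype.card_fin] at this
  omega

end WordTree

theorem connectedTreeDepth_le_of_hom_suffixGraph {α W : Type u} [Finite α] {k : ℕ}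
    {H : SimpleGraph W} (f : H →g suffixGraph α k) (hf : Function.Injective f) :
    H.connectedTreeDepth ≤ k + 1 := by
  refine (Nat.sInf_le ?_).trans (rootedHeight_wordTree_le (α := α) (k := k))
  exact ⟨Word α k, inferInstance, wordTree α k, emptyWord α k, wordTree_isTree,
    ⟨⟨(Hom.ofLE suffixGraph_le_rootedClosure).comp f, hf⟩⟩, rfl⟩

theorem treeDepth_le_of_defectiveColorable {V : Type u} {H : SimpleGraph V} {k d : ℕ}
    (h : ∀ (W : Type u) [Finite W] (G : SimpleGraph W), ¬ H.IsMinorOf G →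
      G.DefectiveColorable k d) : H.treeDepth ≤ k + 1 := by
  let α := ULift.{u} (Fin (d + 1))
  have hm : H.IsMinorOf (suffixGraph α k) := by
    by_contra hcon
    exact not_defectiveColorable_suffixGraph (by simp [α]) (h _ _ hcon)
  obtain ⟨B, hB⟩ := hm.exists_isMinorModel
  obtain ⟨f, hf⟩ := hB.exists_hom_suffixGraph
  refine ciSup_le' fun C => ?_
  exact connectedTreeDepth_le_of_hom_suffixGraph (f.comp C.toSimpleGraph_hom)
    (hf.comp Subtype.val_injective)

/-! ### Lifting models through contractions -/

/-- A minor model in a graph obtained by contracting stars can be lifted: the vertex `v` is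
contracted into `f v`, and every branch set consists of vertices fixed by `f`. -/
theorem IsMinorModel.preimage {W V : Type*} {H : SimpleGraph W} {G J : SimpleGraph V}
    {B : W → Set V} (h : H.IsMinorModel J B) (f : V → V) (hfix : ∀ w, ∀ x ∈ B w, f x = x)
    (hf : ∀ v, f v = v ∨ G.Adj v (f v))
    (hJ : ∀ x y, f x = x → f y = y → J.Adj x y → ∃ x' y', f x' = x ∧ f y' = y ∧ G.Adj x' y') :
    H.IsMinorModel G (fun w => f ⁻¹' B w) where
  connected w := by
    have h1 : ∀ (v : V) (hv : f v ∈ B w), (G.induce (f ⁻¹' B w)).Reachable ⟨v, hv⟩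
        ⟨f v, by rw [Set.mem_preimage, hfix w _ hv]; exact hv⟩ := by
      intro v hv
      rcases hf v with h | h
      · have : (⟨f v, by rw [Set.mem_preimage, hfix w _ hv]; exact hv⟩ : f ⁻¹' B w) = ⟨v, hv⟩ :=
          Subtype.ext h
        rw [this]
      · exact Adj.reachable (G := G.induce (f ⁻¹' B w)) h
    have hmem : ∀ x : B w, (x : V) ∈ f ⁻¹' B w := fun x => by
      rw [Set.mem_preimage, hfix w x x.2]; exact x.2
    have h2 : ∀ x y : B w, (J.induce (B w)).Walk x y →
        (G.induce (f ⁻¹' B w)).Reachable ⟨x, hmem x⟩ ⟨y, hmem y⟩ := by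
      intro x y p
      induction p with
      | nil => exact Reachable.refl _
      | @cons x y z hxy _ ih =>
        refine Reachable.trans ?_ ih
        obtain ⟨x', y', hx, hy, hadj⟩ := hJ x y (hfix w _ x.2) (hfix w _ y.2) hxy
        have hx' : f x' ∈ B w := hx ▸ x.2
        have hy' : f y' ∈ B w := hy ▸ y.2
        have e1 := h1 x' hx'
        have e2 := h1 y' hy'
        simp only [hx, hy] at e1 e2
        exact e1.symm.trans ((Adj.reachable (G := G.induce (f ⁻¹' B w))
          (u := ⟨x', hx'⟩) (v := ⟨y', hy'⟩) hadj).trans e2)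
    obtain ⟨⟨b, hb⟩⟩ := (h.connected w).nonempty
    have : Nonempty (f ⁻¹' B w) := ⟨⟨b, hmem ⟨b, hb⟩⟩⟩
    refine ⟨fun x y => ?_⟩
    obtain ⟨p⟩ := (h.connected w).preconnected ⟨f x, x.2⟩ ⟨f y, y.2⟩
    exact (h1 x x.2).trans ((h2 _ _ p).trans (h1 y y.2).symm)
  disjoint a b x ha hb := h.disjoint a b _ ha hb
  adj a b hab := by
    obtain ⟨x, hx, y, hy, hxy⟩ := h.adj a b hab
    obtain ⟨x', y', rfl, rfl, hadj⟩ := hJ x y (hfix _ _ hx) (hfix _ _ hy) hxy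
    exact ⟨x', hx, y', hy, hadj⟩

/-! ### Edge counting and Mader's theorem -/

/-- The subgraph of `G` consisting of the edges with both ends in `X`. -/
def restrictTo {V : Type*} (G : SimpleGraph V) (X : Set V) : SimpleGraph V where
  Adj x y := G.Adj x y ∧ x ∈ X ∧ y ∈ X
  symm := ⟨fun _ _ h => ⟨h.1.symm, h.2.2, h.2.1⟩⟩
  loopless := ⟨fun _ h => h.1.ne rfl⟩

theorem restrictTo_le {V : Type*} (G : SimpleGraph V) (X : Set V) : G.restrictTo X ≤ G :=
  fun _ _ h => h.1

theorem support_restrictTo_subset {V : Type*} (G : SimpleGraph V) (X : Set V) :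
    (G.restrictTo X).support ⊆ X := by
  rintro x ⟨y, h⟩
  exact h.2.1

theorem restrictTo_eq_self {V : Type*} {G : SimpleGraph V} {X : Set V} (h : G.support ⊆ X) :
    G.restrictTo X = G :=
  le_antisymm (G.restrictTo_le X) fun x y hxy => ⟨hxy, h ⟨y, hxy⟩, h ⟨x, hxy.symm⟩⟩

theorem mul_ncard_le_two_mul_ncard_edgeSet {V : Type*} [Finite V] (G : SimpleGraph V)
    (X : Set V) (m : ℕ) (h : ∀ x ∈ X, m ≤ (G.neighborSet x).ncard) :
    m * X.ncard ≤ 2 * G.edgeSet.ncard := by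
  classical
  have := Fintype.ofFinite V
  have h1 := G.sum_degrees_eq_twice_card_edges
  have h2 : G.edgeFinset.card = G.edgeSet.ncard := by
    rw [← coe_edgeFinset, Set.ncard_coe_finset]
  rw [← h2, ← h1, Set.ncard_eq_toFinset_card', mul_comm, ← smul_eq_mul]
  refine (Finset.card_nsmul_le_sum _ (fun x => G.degree x) m fun x hx => ?_).trans
    (Finset.sum_le_univ_sum_of_nonneg fun _ => Nat.zero_le _)
  refine (h x (Set.mem_toFinset.1 hx)).trans_eq ?_
  rw [Set.ncard_eq_toFinset_card']
  rfl

/-- Contracting `y` into `x` loses at most the edge `xy` and one edge per common neighbour; the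
edges from `y` to `R` become new edges at `x`. -/
theorem ncard_edgeSet_le_contract {V : Type*} [Finite V] (G : SimpleGraph V) (x y : V) :
    G.edgeSet.ncard ≤
      (G.deleteIncidenceSet y ⊔ fromEdgeSet ((fun v => s(x, v)) '' G.neighborSet y)).edgeSet.ncard
        + ((G.neighborSet x ∩ G.neighborSet y).ncard + 1) := by
  set M := G.neighborSet x ∩ G.neighborSet y
  set R := G.neighborSet y \ insert x M
  have hinj : ∀ z : V, Function.Injective fun v => s(z, v) := fun z a b hab =>
    Sym2.congr_right.1 hab
  have h1 : G.edgeSet ⊆ (G.deleteIncidenceSet y).edgeSet ∪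
      ((fun v => s(y, v)) '' R ∪ (fun v => s(y, v)) '' insert x M) := by
    intro e
    induction e with
    | _ a b =>
      intro hab
      rw [mem_edgeSet] at hab
      rw [← Set.image_union, Set.sdiff_union_self]
      by_cases ha : a = y
      · subst ha
        exact Or.inr ⟨b, Or.inl hab, rfl⟩
      by_cases hb : b = y
      · subst hb
        exact Or.inr ⟨a, Or.inl hab.symm, Sym2.eq_swap⟩
      · exact Or.inl (deleteIncidenceSet_adj.2 ⟨hab, ha, hb⟩)
  have h2 : (G.deleteIncidenceSet y).edgeSet ∪ (fun v => s(x, v)) '' R ⊆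
      (G.deleteIncidenceSet y ⊔
        fromEdgeSet ((fun v => s(x, v)) '' G.neighborSet y)).edgeSet := by
    rw [edgeSet_sup, edgeSet_fromEdgeSet]
    refine Set.union_subset_union_right _ ?_
    rintro _ ⟨v, hv, rfl⟩
    refine ⟨⟨v, hv.1, rfl⟩, fun h => hv.2 (Or.inl ?_)⟩
    exact (show x = v from h).symm
  have h3 : Disjoint (G.deleteIncidenceSet y).edgeSet ((fun v => s(x, v)) '' R) := by
    rw [Set.disjoint_left]
    rintro _ h ⟨v, hv, rfl⟩
    exact hv.2 (Or.inr ⟨(deleteIncidenceSet_adj.1 h).1, hv.1⟩)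
  have h4 := Set.ncard_le_ncard h2 (Set.toFinite _)
  rw [Set.ncard_union_eq h3 (Set.toFinite _) (Set.toFinite _),
    Set.ncard_image_of_injective _ (hinj x)] at h4
  have h5 := (Set.ncard_le_ncard h1 (Set.toFinite _)).trans
    ((Set.ncard_union_le _ _).trans (Nat.add_le_add_left (Set.ncard_union_le _ _) _))
  rw [Set.ncard_image_of_injective _ (hinj y), Set.ncard_image_of_injective _ (hinj y)] at h5
  have h6 := Set.ncard_insert_le x M
  omega

theorem isMinorModel_cons {V : Type*} {G J : SimpleGraph V} {p : ℕ} {B : Fin p → Set V} {x : V}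
    (h : (⊤ : SimpleGraph (Fin p)).IsMinorModel J B) (hJ : J ≤ G)
    (hB : ∀ w, B w ⊆ G.neighborSet x) :
    (⊤ : SimpleGraph (Fin (p + 1))).IsMinorModel G (Fin.cons {x} B : Fin (p + 1) → Set V) := by
  have hx : ∀ w, x ∉ B w := fun w hw => (hB w hw).ne rfl
  have h0 : ∀ w, ∃ y ∈ B w, G.Adj x y := fun w => by
    obtain ⟨y, hy⟩ := (h.connected w).nonempty
    exact ⟨y, hy, hB w hy⟩
  refine ⟨fun w => ?_, fun a b y => ?_, fun a b => ?_⟩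
  · refine Fin.cases ?_ (fun w => ?_) w
    · exact connected_induce_singleton G x
    · exact (h.mono hJ).connected w
  · refine Fin.cases (Fin.cases (fun _ _ => rfl) (fun b => ?_) b)
      (fun a => Fin.cases ?_ (fun b => ?_) b) a
    · rintro rfl hb
      exact absurd hb (hx b)
    · rintro ha rfl
      exact absurd ha (hx a)
    · exact fun ha hb => congrArg Fin.succ (h.disjoint a b y ha hb)
  · refine Fin.cases (Fin.cases (fun h => absurd rfl h) (fun b _ => ?_) b)
      (fun a => Fin.cases (fun _ => ?_) (fun b hab => ?_) b) a
    · obtain ⟨y, hy, hxy⟩ := h0 b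
      exact ⟨x, rfl, y, hy, hxy⟩
    · obtain ⟨y, hy, hxy⟩ := h0 a
      exact ⟨y, hy, x, rfl, hxy.symm⟩
    · exact (h.mono hJ).adj a b fun h => hab (congrArg Fin.succ h)

/-- Mader: a graph of large density has a large complete minor. -/
theorem exists_isMinorModel_top_of_le_ncard_edgeSet {V : Type*} [Finite V] (p : ℕ) :
    ∀ (G : SimpleGraph V) (X : Set V), X.Nonempty → G.support ⊆ X →
      2 ^ p * X.ncard ≤ G.edgeSet.ncard →
      ∃ B : Fin p → Set V, (⊤ : SimpleGraph (Fin p)).IsMinorModel G B ∧ ∀ w, B w ⊆ X := by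
  induction p with
  | zero =>
    exact fun G X _ _ _ => ⟨fun _ => ∅, ⟨fun w => w.elim0, fun w => w.elim0, fun w => w.elim0⟩,
      fun w => w.elim0⟩
  | succ p ihp =>
    intro G X
    induction hn : X.ncard using Nat.strong_induction_on generalizing G X with
    | _ n ih =>
    intro hX hsupp hcard
    subst hn
    have hpos : 0 < X.ncard := (Set.ncard_pos (Set.toFinite _)).2 hX
    have hE : G.edgeSet.Nonempty := by
      rw [← Set.ncard_pos (Set.toFinite _)]
      exact (Nat.mul_pos (by positivity) hpos).trans_le hcard
    -- An edge with few common neighbours can be contracted: one vertex and at most `2 ^ (p + 1)`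
    -- edges are lost, so the density hypothesis survives. The vertex `y` stays in `V` as an
    -- isolated vertex, and only `X` shrinks.
    by_cases hlow : ∃ x y, G.Adj x y ∧ (G.neighborSet x ∩ G.neighborSet y).ncard < 2 ^ (p + 1)
    · obtain ⟨x, y, hxy, hlt⟩ := hlow
      have hyX : y ∈ X := hsupp ⟨x, hxy.symm⟩
      have hc := G.ncard_edgeSet_le_contract x y
      set G' := G.deleteIncidenceSet y ⊔ fromEdgeSet ((fun v => s(x, v)) '' G.neighborSet y)
        with hG'
      have hadj : ∀ a b, G'.Adj a b → (G.Adj a b ∧ a ≠ y ∧ b ≠ y) ∨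
          (a = x ∧ G.Adj y b ∧ b ≠ x) ∨ (b = x ∧ G.Adj y a ∧ a ≠ x) := by
        rintro a b (h | ⟨⟨v, hv, he⟩, hne⟩)
        · exact Or.inl (deleteIncidenceSet_adj.1 h)
        · rcases Sym2.eq_iff.1 he with ⟨rfl, rfl⟩ | ⟨rfl, rfl⟩
          · exact Or.inr (Or.inl ⟨rfl, hv, hne.symm⟩)
          · exact Or.inr (Or.inr ⟨rfl, hv, hne⟩)
      have hcardX := Set.ncard_sdiff_singleton_add_one hyX (Set.toFinite _)
      obtain ⟨B, hB, hBX⟩ := ih (X \ {y}).ncard (by omega) G' (X \ {y}) rfl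
        ⟨x, hsupp ⟨y, hxy⟩, hxy.ne⟩ (by
          rintro a ⟨b, hab⟩
          rcases hadj a b hab with h | ⟨rfl, -, -⟩ | ⟨-, h, -⟩
          · exact ⟨hsupp ⟨b, h.1⟩, h.2.1⟩
          · exact ⟨hsupp ⟨y, hxy⟩, hxy.ne⟩
          · exact ⟨hsupp ⟨y, h.symm⟩, h.ne'⟩) (by
          rw [← hcardX, mul_add] at hcard
          omega)
      classical
      refine ⟨_, hB.preimage (fun v => if v = y then x else v) ?_ ?_ ?_, ?_⟩
      · exact fun w v hv => if_neg (hBX w hv).2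
      · intro v
        by_cases h : v = y
        · subst h
          simp [hxy.symm]
        · simp [h]
      · intro a b ha hb hab
        rcases hadj a b hab with h | ⟨rfl, h, -⟩ | ⟨rfl, h, -⟩
        · exact ⟨a, b, ha, hb, h.1⟩
        · exact ⟨y, b, if_pos rfl, hb, h⟩
        · exact ⟨a, y, ha, if_pos rfl, h.symm⟩
      · intro w v hv
        by_cases h : v = y
        · exact h ▸ hyX
        · rw [Set.mem_preimage, if_neg h] at hv
          exact (hBX w hv).1
    -- Now every vertex of `N(x)` has at least `2 ^ (p + 1)` neighbours inside `N(x)`. So `N(x)`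
    -- spans at least `2 ^ p * |N(x)|` edges and contains a model of `K_p`, to which `x` is added.
    · push Not at hlow
      obtain ⟨e, he⟩ := hE
      induction e with
      | _ x y =>
      rw [mem_edgeSet] at he
      obtain ⟨B, hB, hBX⟩ := ihp (G.restrictTo (G.neighborSet x)) (G.neighborSet x) ⟨y, he⟩
        (G.support_restrictTo_subset _) (by
          have := (G.restrictTo (G.neighborSet x)).mul_ncard_le_two_mul_ncard_edgeSet
            (G.neighborSet x) (2 ^ (p + 1)) (fun v hv => by
              refine (hlow x v hv).trans (Set.ncard_le_ncard ?_ (Set.toFinite _))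
              exact fun z hz => ⟨hz.2, hv, hz.1⟩)
          rw [pow_succ] at this
          linarith)
      refine ⟨_, isMinorModel_cons hB (G.restrictTo_le _) hBX, fun w => ?_⟩
      refine Fin.cases ?_ (fun w => ?_) w
      · rintro _ rfl
        exact hsupp ⟨y, he⟩
      · exact fun v hv => hsupp ⟨x, (hBX w hv).symm⟩

theorem exists_isMinorModel_of_le_ncard_edgeSet {W V : Type*} [Finite W] [Finite V]
    (H : SimpleGraph W) (G : SimpleGraph V) (X : Set V) (hX : X.Nonempty) (hG : G.support ⊆ X)
    (h : 2 ^ Nat.card W * X.ncard ≤ G.edgeSet.ncard) :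
    ∃ B : W → Set V, H.IsMinorModel G B ∧ ∀ w, B w ⊆ X := by
  obtain ⟨B, hB, hBX⟩ := exists_isMinorModel_top_of_le_ncard_edgeSet _ G X hX hG h
  let e := Finite.equivFin W
  exact ⟨fun w => B (e w), hB.comp ⟨e, fun {a b} hab => e.injective.ne hab.ne⟩ e.injective,
    fun w => hBX _⟩

/-! ### Cliques, subdivisions and light edges -/

/-- A `D`-degenerate graph has at most `2 ^ D` times as many cliques as vertices. -/
theorem card_cliques_le {V : Type*} (J : SimpleGraph V) (D : ℕ) (X : Finset V)
    (hJ : ∀ Y ⊆ X, Y.Nonempty → ∃ v ∈ Y, (J.neighborSet v ∩ Y).ncard ≤ D)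
    (𝒬 : Finset (Finset V)) (h𝒬 : ∀ Q ∈ 𝒬, Q ⊆ X ∧ Q.Nonempty ∧ J.IsClique Q) :
    𝒬.card ≤ 2 ^ D * X.card := by
  classical
  induction hn : X.card generalizing X 𝒬 with
  | zero =>
    rw [Finset.card_eq_zero] at hn
    subst hn
    have : 𝒬 = ∅ := Finset.eq_empty_of_forall_notMem fun Q hQ => by
      obtain ⟨h1, h2, -⟩ := h𝒬 Q hQ
      exact h2.ne_empty (Finset.subset_empty.1 h1)
    simp [this]
  | succ n ih =>
    obtain ⟨v, hv, hD⟩ := hJ X subset_rfl (Finset.card_pos.1 (by omega))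
    have h1 := ih (X.erase v) (fun Y hY => hJ Y (hY.trans (Finset.erase_subset _ _)))
      (𝒬.filter fun Q => v ∉ Q) (fun Q hQ => by
        rw [Finset.mem_filter] at hQ
        obtain ⟨h1, h2⟩ := h𝒬 Q hQ.1
        exact ⟨fun z hz => Finset.mem_erase.2 ⟨fun h => hQ.2 (h ▸ hz), h1 hz⟩, h2⟩)
      (by rw [Finset.card_erase_of_mem hv]; omega)
    have hfin : (J.neighborSet v ∩ X).Finite := X.finite_toSet.inter_of_right _
    -- A clique through `v` is determined by its other members, which are among at most `D`
    -- neighbours of `v`.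
    have h2 : 𝒬.filter (fun Q => v ∈ Q) ⊆ hfin.toFinset.powerset.image (insert v) := by
      intro Q hQ
      rw [Finset.mem_filter] at hQ
      obtain ⟨hQX, -, hcl⟩ := h𝒬 Q hQ.1
      refine Finset.mem_image.2 ⟨Q.erase v, Finset.mem_powerset.2 fun z hz => ?_,
        Finset.insert_erase hQ.2⟩
      rw [Finset.mem_erase] at hz
      exact hfin.mem_toFinset.2 ⟨hcl hQ.2 hz.2 hz.1.symm, hQX hz.2⟩
    have h3 := (Finset.card_le_card h2).trans Finset.card_image_le
    rw [Finset.card_powerset, ← Set.ncard_eq_toFinset_card _ hfin] at h3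
    have h4 := h3.trans (Nat.pow_le_pow_right two_pos hD)
    have h5 := Finset.card_filter_add_card_filter_not (s := 𝒬) (fun Q => v ∈ Q)
    rw [mul_add, mul_one]
    omega

/-- A maximal graph `J` having a `1`-subdivision in `G` whose division vertices `S` lie in `A`. -/
theorem exists_maximal_subdivision {V : Type*} [Finite V] (G : SimpleGraph V) (A : Finset V) :
    ∃ (S : Finset V) (q : V → V × V) (J : SimpleGraph V), S ⊆ A ∧
      (∀ v ∈ S, G.Adj v (q v).1 ∧ G.Adj v (q v).2) ∧
      (∀ x y, J.Adj x y → ∃ v ∈ S, s((q v).1, (q v).2) = s(x, y)) ∧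
      J.edgeSet.ncard = S.card ∧
      ∀ v ∈ A, v ∉ S → ∀ x y, G.Adj v x → G.Adj v y → x ≠ y → J.Adj x y := by
  classical
  have := Fintype.ofFinite V
  let e : (V → V × V) → V → Sym2 V := fun q v => s((q v).1, (q v).2)
  -- The vertex `v` subdivides the edge joining the two entries of `q v`; injectivity gives each
  -- edge a single division vertex.
  let P : Finset V → (V → V × V) → Prop := fun S q => S ⊆ A ∧
    (∀ v ∈ S, G.Adj v (q v).1 ∧ G.Adj v (q v).2 ∧ (q v).1 ≠ (q v).2) ∧
    Set.InjOn (e q) S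
  obtain ⟨S, hS, hmax⟩ := (Finset.univ.filter fun S => ∃ q, P S q).exists_max_image Finset.card
    ⟨∅, by
      rw [Finset.mem_filter]
      exact ⟨Finset.mem_univ _, fun v => (v, v), by simp [P]⟩⟩
  rw [Finset.mem_filter] at hS
  obtain ⟨-, q, hSA, hq, hinj⟩ := hS
  refine ⟨S, q, fromEdgeSet (e q '' S), hSA, fun v hv => ⟨(hq v hv).1, (hq v hv).2.1⟩, ?_, ?_, ?_⟩
  · rintro x y ⟨⟨v, hv, h⟩, -⟩
    exact ⟨v, hv, h⟩
  · rw [edgeSet_fromEdgeSet, sdiff_eq_left.2, hinj.ncard_image, Set.ncard_coe_finset]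
    rw [Set.disjoint_left]
    rintro _ ⟨v, hv, rfl⟩ h
    exact (hq v hv).2.2 h
  · intro v hvA hvS x y hx hy hxy
    refine ⟨?_, hxy⟩
    by_contra hne
    have hne' : ∀ w ∈ S, w ≠ v := fun w hw h => hvS (h ▸ hw)
    have heq : ∀ w ∈ S, Function.update q v (x, y) w = q w := fun w hw =>
      Function.update_of_ne (hne' w hw) _ _
    -- If `xy` were not an edge of `J`, the unused `v` could subdivide it, against maximality of
    -- `S`.
    have hP : P (insert v S) (Function.update q v (x, y)) := by
      refine ⟨Finset.insert_subset hvA hSA, fun w hw => ?_, ?_⟩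
      · rcases Finset.mem_insert.1 hw with rfl | hw
        · rw [Function.update_self]
          exact ⟨hx, hy, hxy⟩
        · rw [heq w hw]
          exact hq w hw
      · have heq' : Set.EqOn (e q) (e (Function.update q v (x, y))) S := fun w hw => by
          simp only [e, heq w hw]
        rw [Finset.coe_insert, Set.injOn_insert (by exact hvS)]
        refine ⟨hinj.congr heq', ?_⟩
        rw [← heq'.image_eq]
        simp only [e, Function.update_self]
        exact fun h => hne h
    have := hmax (insert v S) (Finset.mem_filter.2 ⟨Finset.mem_univ _, _, hP⟩)
    rw [Finset.card_insert_of_notMem hvS] at this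
    omega

/-- Used to place a vertex cover on a clique and the other vertices on common neighbours of that
clique. -/
theorem exists_injective_cover_map {W V : Type*} [Finite W] (C : Set W) (Q F : Finset V)
    (hQ : Q.card = C.ncard) (hF : Nat.card W ≤ F.card) (hd : Disjoint Q F) :
    ∃ f : W → V, Function.Injective f ∧ (∀ w ∈ C, f w ∈ Q) ∧ ∀ w ∉ C, f w ∈ F := by
  classical
  have := Fintype.ofFinite W
  obtain ⟨g⟩ : Nonempty (W ↪ F) := Function.Embedding.nonempty_of_card_le (by
    rwa [Fintype.card_coe, ← Nat.card_eq_fintype_card])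
  obtain ⟨e⟩ : Nonempty (C ↪ Q) := Function.Embedding.nonempty_of_card_le (by
    rw [Fintype.card_coe, ← Nat.card_eq_fintype_card, hQ]
    exact le_rfl)
  refine ⟨fun w => if h : w ∈ C then e ⟨w, h⟩ else g w, fun a b hab => ?_, fun w hw => ?_,
    fun w hw => ?_⟩
  · by_cases ha : a ∈ C <;> by_cases hb : b ∈ C <;> simp only [ha, hb, dif_pos, dif_neg,
      not_false_eq_true] at hab
    · exact congrArg Subtype.val (e.injective (Subtype.ext hab))
    · exact absurd (hab ▸ (e ⟨a, ha⟩).2) fun h => Finset.disjoint_left.1 hd h (g b).2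
    · exact absurd (hab ▸ (g a).2) fun h => Finset.disjoint_left.1 hd (e ⟨b, hb⟩).2 h
    · exact g.injective (Subtype.ext hab)
  · simp only [hw, dif_pos, Finset.coe_mem]
  · simp only [hw, dif_neg, not_false_eq_true, Finset.coe_mem]

/-- The degree bound for light edges in graphs excluding a minor on `t` vertices. -/
def lightDegree (t : ℕ) : ℕ :=
  2 * 2 ^ t * (1 + 2 ^ t + t * 2 ^ (2 * 2 ^ t))

/-- In a graph without `H`-minor there is a vertex of positive degree less than the size of a
vertex cover of `H`, or an edge whose ends both have bounded degree. -/
theorem exists_low_degree_or_light_edge {W V : Type*} [Finite W] [Finite V] {H : SimpleGraph W}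
    {C : Set W} (hC : H.IsVertexCover C) (hs : 0 < C.ncard) {G : SimpleGraph V} (hne : G ≠ ⊥)
    (hG : ∀ B : W → Set V, ¬ H.IsMinorModel G B) :
    (∃ v, 0 < (G.neighborSet v).ncard ∧ (G.neighborSet v).ncard < C.ncard) ∨
      ∃ x y, G.Adj x y ∧ (G.neighborSet x).ncard ≤ lightDegree (Nat.card W) ∧
        (G.neighborSet y).ncard ≤ lightDegree (Nat.card W) := by
  classical
  have := Fintype.ofFinite V
  by_contra! hcon
  obtain ⟨hdeg, hlight⟩ := hcon
  set t := Nat.card W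
  set ℓ := lightDegree t with hℓ
  set c := 2 ^ t with hc
  have hpos : ∀ {x y}, G.Adj x y → 0 < (G.neighborSet x).ncard := fun {x y} h =>
    (Set.ncard_pos (Set.toFinite _)).2 ⟨y, h⟩
  let A : Finset V := Finset.univ.filter fun v =>
    0 < (G.neighborSet v).ncard ∧ (G.neighborSet v).ncard ≤ ℓ
  let X : Finset V := Finset.univ.filter fun v => ℓ < (G.neighborSet v).ncard
  have hA : ∀ v, v ∈ A ↔ 0 < (G.neighborSet v).ncard ∧ (G.neighborSet v).ncard ≤ ℓ := fun v => by
    simp [A]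
  have hX : ∀ v, v ∈ X ↔ ℓ < (G.neighborSet v).ncard := fun v => by simp [X]
  have hdisj : Disjoint X A := Finset.disjoint_left.2 fun v h1 h2 =>
    absurd ((hX v).1 h1) (not_lt.2 ((hA v).1 h2).2)
  have hAX : ∀ v ∈ A, ∀ x, G.Adj v x → x ∈ X := fun v hv x hvx =>
    (hX x).2 (hlight v x hvx ((hA v).1 hv).2)
  have hsupp : G.support ⊆ ((A ∪ X : Finset V) : Set V) := by
    rintro v ⟨y, hvy⟩
    rw [Finset.mem_coe, Finset.mem_union]
    by_cases h : v ∈ X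
    · exact Or.inr h
    · exact Or.inl ((hA v).2 ⟨hpos hvy, not_lt.1 fun h' => h ((hX v).2 h')⟩)
  obtain ⟨a, b, hab⟩ := ne_bot_iff_exists_adj.1 hne
  have hXne : X.Nonempty := by
    rcases Finset.mem_union.1 (hsupp ⟨b, hab⟩) with h | h
    · exact ⟨b, hAX a h b hab⟩
    · exact ⟨a, h⟩
  have hGcard : G.edgeSet.ncard < c * (A.card + X.card) := by
    by_contra! h
    obtain ⟨B, hB, -⟩ := H.exists_isMinorModel_of_le_ncard_edgeSet G _ ⟨a, hsupp ⟨b, hab⟩⟩ hsupp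
      (by rwa [Set.ncard_coe_finset, Finset.card_union_of_disjoint hdisj.symm])
    exact hG B hB
  have hXdeg : (ℓ + 1) * X.card ≤ 2 * G.edgeSet.ncard := by
    rw [← Set.ncard_coe_finset]
    exact G.mul_ncard_le_two_mul_ncard_edgeSet _ _ fun x hx => (hX x).1 hx
  obtain ⟨S, q, J, hSA, hq, hJq, hJS, hJmax⟩ := G.exists_maximal_subdivision A
  have hqX : ∀ v ∈ S, (q v).1 ∈ X ∧ (q v).2 ∈ X := fun v hv =>
    ⟨hAX v (hSA hv) _ (hq v hv).1, hAX v (hSA hv) _ (hq v hv).2⟩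
  have hXS : ∀ v ∈ X, v ∉ S := fun v hv h => Finset.disjoint_left.1 hdisj hv (hSA h)
  -- Models avoiding `S` in `J ⊔ G` lift to models in `G`.
  have hlift : ∀ B : W → Set V, (∀ w, ∀ x ∈ B w, x ∉ S) → ¬ H.IsMinorModel (J ⊔ G) B := by
    intro B hBS hB
    refine hG _ (hB.preimage (fun v => if v ∈ S then (q v).1 else v) ?_ ?_ ?_)
    · exact fun w x hx => if_neg (hBS w x hx)
    · intro v
      by_cases hv : v ∈ S
      · exact Or.inr (by simpa [hv] using (hq v hv).1)
      · exact Or.inl (if_neg hv)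
    · rintro x y hx hy (h | h)
      · obtain ⟨v, hv, he⟩ := hJq x y h
        rcases Sym2.eq_iff.1 he with ⟨rfl, rfl⟩ | ⟨rfl, rfl⟩
        · exact ⟨v, _, if_pos hv, hy, (hq v hv).2⟩
        · exact ⟨_, v, hx, if_pos hv, (hq v hv).2.symm⟩
      · exact ⟨x, y, hx, hy, h⟩
  have hJsparse : ∀ Y ⊆ X, Y.Nonempty → (J.restrictTo Y).edgeSet.ncard < c * Y.card := by
    intro Y hYX hY
    by_contra! h
    obtain ⟨B, hB, hBY⟩ := H.exists_isMinorModel_of_le_ncard_edgeSet (J.restrictTo Y) Y hY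
      (J.support_restrictTo_subset _) (by rwa [Set.ncard_coe_finset])
    exact hlift B (fun w x hx => hXS x (hYX (hBY w hx)))
      (hB.mono ((J.restrictTo_le _).trans le_sup_left))
  have hScard : S.card ≤ c * X.card := by
    have h := hJsparse X subset_rfl hXne
    rw [restrictTo_eq_self, hJS] at h
    · exact h.le
    · rintro x ⟨y, hxy⟩
      obtain ⟨v, hv, he⟩ := hJq x y hxy
      rcases Sym2.eq_iff.1 he with ⟨rfl, rfl⟩ | ⟨rfl, rfl⟩
      · exact (hqX v hv).1
      · exact (hqX v hv).2
  have hcl : ∀ v, ∃ Q : Finset V, v ∈ A → Q.card = C.ncard ∧ ∀ x ∈ Q, G.Adj v x := by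
    intro v
    by_cases hv : v ∈ A
    · have h := hdeg v ((hA v).1 hv).1
      rw [Set.ncard_eq_toFinset_card (G.neighborSet v) (Set.toFinite _)] at h
      obtain ⟨Q, hQ, hQc⟩ := Finset.exists_subset_card_eq h
      exact ⟨Q, fun _ => ⟨hQc, fun x hx => (Set.toFinite _).mem_toFinset.1 (hQ hx)⟩⟩
    · exact ⟨∅, fun h => absurd h hv⟩
  choose Q hQ using hcl
  have hQX : ∀ v ∈ A, Q v ⊆ X := fun v hv x hx => hAX v hv x ((hQ v hv).2 x hx)
  -- By maximality of the subdivision, the neighbours of an unused `v` are pairwise adjacent in `J`.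
  have hQcl : ∀ v ∈ A \ S, J.IsClique (Q v) := by
    intro v hv x hx y hy hxy
    rw [Finset.mem_sdiff] at hv
    exact hJmax v hv.1 hv.2 x y ((hQ v hv.1).2 x hx) ((hQ v hv.1).2 y hy) hxy
  have himage : ((A \ S).image Q).card ≤ 2 ^ (2 * c) * X.card := by
    refine J.card_cliques_le (2 * c) X (fun Y hY hYne => ?_) _ fun R hR => ?_
    -- Every nonempty `Y ⊆ X` spans fewer than `c * |Y|` edges of `J`, so some vertex has at most `2
    -- * c` neighbours in `Y`.
    · by_contra! h
      have h1 := (J.restrictTo Y).mul_ncard_le_two_mul_ncard_edgeSet Y (2 * c + 1)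
        fun v hv => (h v hv).trans_le (Set.ncard_le_ncard
          (fun z hz => ⟨hz.1, hv, hz.2⟩) (Set.toFinite _))
      rw [Set.ncard_coe_finset] at h1
      have h2 := hJsparse Y hY hYne
      nlinarith
    · obtain ⟨v, hv, rfl⟩ := Finset.mem_image.1 hR
      have hv' := (Finset.mem_sdiff.1 hv).1
      refine ⟨hQX v hv', Finset.card_pos.1 ?_, hQcl v hv⟩
      rwa [(hQ v hv').1]
  have hfiber : (A \ S).card ≤ t * ((A \ S).image Q).card := by
    refine Finset.card_le_mul_card_image _ _ fun R hR => ?_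
    by_contra! h
    obtain ⟨v, hv, rfl⟩ := Finset.mem_image.1 hR
    have hv' := (Finset.mem_sdiff.1 hv).1
    -- More than `t` vertices choosing the same clique would put `H` into `J ⊔ G`: the cover goes to
    -- the clique and the rest, an independent set, to `F`.
    set F := (A \ S).filter fun x => Q x = Q v
    have hF : ∀ x ∈ F, x ∈ A ∧ x ∉ S ∧ Q x = Q v := fun x hx => by
      rw [Finset.mem_filter, Finset.mem_sdiff] at hx
      exact ⟨hx.1.1, hx.1.2, hx.2⟩
    obtain ⟨f, hf, hfC, hfF⟩ := exists_injective_cover_map C (Q v) F (hQ v hv').1 h.le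
      (Finset.disjoint_left.2 fun x h1 h2 =>
        Finset.disjoint_left.1 hdisj (hQX v hv' h1) (hF x h2).1)
    have hmix : ∀ x y, x ∈ C → y ∉ C → G.Adj (f x) (f y) := fun x y hx hy => by
      obtain ⟨h1, -, h2⟩ := hF _ (hfF y hy)
      exact ((hQ _ h1).2 _ (h2 ▸ hfC x hx)).symm
    refine hlift (fun w => {f w}) ?_ (isMinorModel_singleton ⟨f, fun {x y} hxy => ?_⟩ hf)
    · rintro w _ rfl
      by_cases hw : w ∈ C
      · exact hXS _ (hQX v hv' (hfC w hw))
      · exact (hF _ (hfF w hw)).2.1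
    · by_cases hx : x ∈ C <;> by_cases hy : y ∈ C
      · exact Or.inl (hQcl v hv (hfC x hx) (hfC y hy) (hf.ne hxy.ne))
      · exact Or.inr (hmix x y hx hy)
      · exact Or.inr (hmix y x hy hx).symm
      · exact absurd (hC hxy) (not_or.2 ⟨hx, hy⟩)
  have hAcard : A.card ≤ (c + t * 2 ^ (2 * c)) * X.card := by
    have h1 := Finset.card_sdiff_add_card_eq_card hSA
    have h2 := hfiber.trans (Nat.mul_le_mul_left t himage)
    rw [← mul_assoc] at h2
    rw [add_mul]
    omega
  have h1 : c * (A.card + X.card) ≤ c * ((c + t * 2 ^ (2 * c)) * X.card + X.card) :=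
    Nat.mul_le_mul_left _ (Nat.add_le_add_right hAcard _)
  -- `lightDegree` is chosen so that this bound on twice the number of edges is exactly `ℓ * |X|`,
  -- whereas the degrees in `X` sum to at least `(ℓ + 1) * |X|`.
  have h2 : 2 * (c * ((c + t * 2 ^ (2 * c)) * X.card + X.card)) = ℓ * X.card := by
    rw [hℓ, lightDegree, ← hc]
    ring
  have h3 : (ℓ + 1) * X.card = ℓ * X.card + X.card := by ring
  have h4 := hXne.card_pos
  omega

/-! ### Colouring by induction on the edges -/

/-- Recolour `v` with a colour absent from its neighbourhood; then its edges join different colours.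
-/
theorem DefectiveColorable.of_deleteIncidenceSet {V : Type u} [Finite V] {G : SimpleGraph V}
    {k d : ℕ} {v : V} (hv : (G.neighborSet v).ncard < k)
    (h : (G.deleteIncidenceSet v).DefectiveColorable k d) : G.DefectiveColorable k d := by
  classical
  obtain ⟨c, hc⟩ := h
  obtain ⟨i, hi⟩ : ∃ i, i ∉ c '' G.neighborSet v := by
    by_contra! hcon
    have h1 := Set.ncard_image_le (f := c) (Set.toFinite (G.neighborSet v))
    rw [Set.eq_univ_of_forall hcon, Set.ncard_univ, Nat.card_fin] at h1
    omega
  have hi' : ∀ x, G.Adj v x → c x ≠ i := fun x hx h => hi ⟨x, hx, h⟩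
  refine ⟨Function.update c v i, fun w => (Set.encard_le_encard ?_).trans (hc w)⟩
  rintro x ⟨hwx, hcx⟩
  by_cases hw : w = v
  · subst hw
    rw [Function.update_self, Function.update_of_ne hwx.ne'] at hcx
    exact absurd hcx (hi' x hwx)
  · by_cases hx : x = v
    · subst hx
      rw [Function.update_self, Function.update_of_ne hw] at hcx
      exact absurd hcx.symm (hi' w hwx.symm)
    · rw [Function.update_of_ne hw, Function.update_of_ne hx] at hcx
      exact ⟨deleteIncidenceSet_adj.2 ⟨hwx, hw, hx⟩, hcx⟩

/-- Restoring the edge affects only `x` and `y`, whose degrees are at most `d` under any colouring.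
-/
theorem DefectiveColorable.of_deleteEdge {V : Type u} [Finite V] {G : SimpleGraph V}
    {k d : ℕ} {x y : V} (hx : (G.neighborSet x).ncard ≤ d) (hy : (G.neighborSet y).ncard ≤ d)
    (h : (G.deleteEdges {s(x, y)}).DefectiveColorable k d) : G.DefectiveColorable k d := by
  obtain ⟨c, hc⟩ := h
  refine ⟨c, fun v => ?_⟩
  by_cases hv : v = x ∨ v = y
  · have h1 : (G.neighborSet v).ncard ≤ d := by
      rcases hv with rfl | rfl <;> assumption
    refine (Set.encard_le_encard (fun w hw => hw.1 : _ ⊆ G.neighborSet v)).trans ?_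
    rw [← (Set.toFinite (G.neighborSet v)).cast_ncard_eq]
    exact_mod_cast h1
  · refine (Set.encard_le_encard ?_).trans (hc v)
    rintro w ⟨hvw, hcw⟩
    refine ⟨deleteEdges_adj.2 ⟨hvw, fun h => hv ?_⟩, hcw⟩
    rcases Sym2.eq_iff.1 h with ⟨h, -⟩ | ⟨h, -⟩
    · exact Or.inl h
    · exact Or.inr h

theorem defectiveColorable_of_isVertexCover {W : Type*} {V : Type u} [Finite W] [Finite V]
    {H : SimpleGraph W} {C : Set W} (hC : H.IsVertexCover C) (hs : 0 < C.ncard)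
    (G : SimpleGraph V) (hG : ∀ B : W → Set V, ¬ H.IsMinorModel G B) :
    G.DefectiveColorable C.ncard (lightDegree (Nat.card W)) := by
  induction hn : G.edgeSet.ncard using Nat.strong_induction_on generalizing G with
  | _ n ih =>
  subst hn
  by_cases hne : G = ⊥
  · subst hne
    exact ⟨fun _ => ⟨0, hs⟩, fun v => by simp⟩
  have step : ∀ G' < G, G'.DefectiveColorable C.ncard (lightDegree (Nat.card W)) := fun G' h =>
    ih _ (Set.ncard_lt_ncard (edgeSet_ssubset_edgeSet.2 h) (Set.toFinite _)) G'
      (fun B hB => hG B (hB.mono h.le)) rfl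
  rcases exists_low_degree_or_light_edge hC hs hne hG with ⟨v, hv0, hv⟩ | ⟨x, y, hxy, hx, hy⟩
  · refine .of_deleteIncidenceSet hv (step _ ((G.deleteIncidenceSet_le v).lt_of_not_ge fun h => ?_))
    obtain ⟨w, hw⟩ := (Set.ncard_pos (Set.toFinite _)).1 hv0
    exact (deleteIncidenceSet_adj.1 (h hw)).2.1 rfl
  · refine .of_deleteEdge hx hy (step _ ((G.deleteEdges_le _).lt_of_not_ge fun h => ?_))
    exact (deleteEdges_adj.1 (h hxy)).2 rfl

/-! ### Edgeless `H` and the conclusion -/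

theorem nat_card_lt_of_not_isMinorOf_bot {W V : Type u} [Finite W] [Finite V]
    {G : SimpleGraph V} (h : ¬ (⊥ : SimpleGraph W).IsMinorOf G) : Nat.card V < Nat.card W := by
  by_contra! hcard
  have := Fintype.ofFinite W
  have := Fintype.ofFinite V
  rw [Nat.card_eq_fintype_card, Nat.card_eq_fintype_card] at hcard
  obtain ⟨f⟩ := Function.Embedding.nonempty_of_card_le hcard
  exact h (isMinorModel_singleton (H := ⊥) (G := G) ⟨f, fun h => h.elim⟩ f.injective).isMinorOf

/-- Such a `G` has fewer vertices than `W`, so one colour suffices. If `W` has at most one vertex,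
`G` is empty and the number of colours given by `min` is `0`, as the bound by the vertex cover
number requires. -/
theorem defectiveColorable_of_not_isMinorOf_bot {W V : Type u} [Finite W] [Finite V]
    {G : SimpleGraph V} (h : ¬ (⊥ : SimpleGraph W).IsMinorOf G) :
    G.DefectiveColorable (min 1 (Nat.card W - 1)) (Nat.card W) := by
  have hcard := nat_card_lt_of_not_isMinorOf_bot h
  rcases isEmpty_or_nonempty V with hV | hV
  · exact ⟨fun v => hV.elim v, fun v => hV.elim v⟩
  · have hpos := Nat.card_pos (α := V)
    refine ⟨fun _ => ⟨0, by omega⟩, fun v => (Set.encard_le_encard (Set.subset_univ _)).trans ?_⟩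
    rw [Set.encard_univ, ENat.card_eq_coe_natCard]
    exact_mod_cast hcard.le

theorem exists_defectiveColorable_of_ne_bot {V : Type u} [Finite V] {H : SimpleGraph V}
    (hH : H ≠ ⊥) : ∃ k d : ℕ, (k : ℕ∞) = H.vertexCoverNum ∧
      ∀ (W : Type u) [Finite W] (G : SimpleGraph W), ¬ H.IsMinorOf G →
        G.DefectiveColorable k d := by
  obtain ⟨C, hCcard, hC⟩ := H.vertexCoverNum_exists
  have hcast := (Set.toFinite C).cast_ncard_eq
  refine ⟨C.ncard, lightDegree (Nat.card V), hcast.trans hCcard, fun W _ G hG =>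
    defectiveColorable_of_isVertexCover hC (Nat.pos_of_ne_zero fun h => hH ?_) G
      fun B hB => hG hB.isMinorOf⟩
  rw [← vertexCoverNum_eq_zero, ← hCcard, ← hcast, h, Nat.cast_zero]

end SimpleGraph

theorem mainTheorem10 {V : Type u} [Finite V] (H : SimpleGraph V) :
    ∃ f : ℕ, IsDefectiveChromaticNumber (minorFreeClass H) f ∧
      (H.treeDepth : ℤ) - 1 ≤ (f : ℤ) ∧
      ((H ≠ ⊥ ∨ Nat.card V ≤ 1) → (f : ℕ∞) ≤ H.vertexCoverNum) := by
  obtain ⟨k, d, hk, hcol⟩ : ∃ k d : ℕ,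
      ((H ≠ ⊥ ∨ Nat.card V ≤ 1) → (k : ℕ∞) ≤ H.vertexCoverNum) ∧
      ∀ (W : Type u) [Finite W] (G : SimpleGraph W), minorFreeClass H W G →
        G.DefectiveColorable k d := by
    by_cases hH : H = ⊥
    · subst hH
      refine ⟨min 1 (Nat.card V - 1), Nat.card V, fun h => ?_, fun W _ G hG =>
        SimpleGraph.defectiveColorable_of_not_isMinorOf_bot hG⟩
      have h1 := h.resolve_left fun h => h rfl
      rw [Nat.sub_eq_zero_of_le h1]
      exact bot_le
    · obtain ⟨k, d, hk, hcol⟩ := SimpleGraph.exists_defectiveColorable_of_ne_bot hH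
      exact ⟨k, d, fun _ => hk.le, hcol⟩
  let K : Set ℕ := {k | ∃ d : ℕ, ∀ (W : Type u) [Finite W] (G : SimpleGraph W),
    minorFreeClass H W G → G.DefectiveColorable k d}
  have hkK : k ∈ K := ⟨d, hcol⟩
  have hmem : sInf K ∈ K := Nat.sInf_mem ⟨k, hkK⟩
  refine ⟨sInf K, ⟨hmem, fun _ h => Nat.sInf_le h⟩, ?_, fun h => ?_⟩
  · obtain ⟨d, hd⟩ := hmem
    have := SimpleGraph.treeDepth_le_of_defectiveColorable hd
    omega
  · exact le_trans (by exact_mod_cast Nat.sInf_le hkK) (hk h)
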